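/- Let $k$ be a field of characteristic zero with algebraic closure $\bar k$. **Conventions.** A quadratic rational map over $\bar k$ is $\varphi=[F_0:F_1]$ with $F_0,F_1\in\bar k[X_0,X_1]$ quadratic forms without common factor; it is attached to the pair $(f,g)$ consisting of the linear form $f=\partial F_0/\partial X_0+\partial F_1/\partial X_1$ and the cubic form $g=X_1F_0-X_0F_1$. For $\gamma\in \mathrm{PGL}_2(\bar k)$ put $\varphi^\gamma=\gamma^{-1}\circ\varphi\circ\gamma$. $M_2(\bar k)$ is the set of conjugacy classes of quadratic maps, $[f,g]\in M_2(\bar k)$ is the class of the map attached to $(f,g)$, and $M_2(k)$ is the set of points of $M_2(\bar k)$ fixed by $\mathrm{Gal}(\bar k/k)$. For binary forms $F,G$ of orders $m,n$ let $$(F,G)_q=\frac{(m-q)!\,(n-q)!}{m!\,n!}\sum_{j=0}^{q}(-1)^j\binom qj\,\frac{\partial^q F}{\partial X_0^{j}\partial X_1^{q-j}}\,\frac{\partial^q G}{\partial X_0^{q-j}\partial X_1^{j}} .$$ For a pair $(f,g)$ put $H=(g,g)_2$, $t=(g,H)_1$, $$s_1=(g,f^3)_3,\quad s_2=(H,f^2)_2,\quad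 s_3=(t,g)_3,\quad r=(t,f^3)_3,$$ $$V_0=(H,f)_1,\quad V_1=(g,f^2)_2,\quad b_0=(V_1,f)_1,\quad b_1=(V_0,f)_1,\quad a_{ijl}=D_{V_i}D_{V_j}D_{V_l}\,g,$$ where $D_V=\frac13\left(\frac{\partial V}{\partial X_0}\frac{\partial}{\partial X_1}-\frac{\partial V}{\partial X_1}\frac{\partial}{\partial X_0}\right)$ for a linear form $V$. Weighted coordinates of a point $P\in M_2(\bar k)$ are the tuples $(\alpha^4s_1,\alpha^4s_2,\alpha^4s_3,\alpha^6r)$, where $\alpha\in\bar k^\times$ and $s_1,s_2,s_3,r$ are evaluated at a map of class $P$. **Theorem.** Let $P\in M_2(k)$ be the class of maps with trivial automorphism group in $\mathrm{PGL}_2(\bar k)$, and let $s_1,s_2,s_3,r\in k$ be weighted coordinates of $P$. Then $r\neq 0$. There is a map of class $P$ over $\bar k$ whose invariants are exactly $s_1,s_2,s_3,r$, and for every such map the invariants $b_i,a_{ijl}$ lie in $k$ and are given by $$b_0=s_1,\quad b_1=s_2,\quad a_{000}=\tfrac19 s_3r,\quad a_{100}=0,\quad a_{110}=-\tfrac19 s_2r,\quad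 a_{111}=-\tfrac29 s_1r,$$ with $a_{ijl}$ symmetric in its indices. Let $W_0,W_1\in k[X_0,X_1]$ be any linear forms for which the coordinate transformation $X_0\mapsto W_0$, $X_1\mapsto W_1$ is in $\mathrm{SL}_2(k)$. Then the forms $$f=b_0W_0-b_1W_1,\qquad g=\frac{9}{2r}\sum_{i,j,l\in\mathbb F_2}(-1)^{i+j+l}a_{ijl}\,W_{i+1}W_{j+1}W_{l+1}$$ have coefficients in $k$, and $[f,g]=P$: the pair $(f,g)$ is attached to a quadratic rational map $[F_0:F_1]$ with $F_0,F_1\in k[X_0,X_1]$ whose class is $P$. -/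

import Mathlib

open MvPolynomial

/-! ### Quadratic rational maps and their moduli -/

/-- The conjugate `γ⁻¹ ∘ F ∘ γ` of a pair of forms `F = (F₀, F₁)` in `X₀, X₁` by a matrix `γ`,
which acts on the coordinates by `X_i ↦ γ_{i0} X₀ + γ_{i1} X₁`. -/
noncomputable def conjForms {K : Type*} [Field K] (γ : GL (Fin 2) K)
    (F : Fin 2 → MvPolynomial (Fin 2) K) : Fin 2 → MvPolynomial (Fin 2) K :=
  fun i => ∑ j, C ((γ⁻¹).val i j) * aeval (fun a => ∑ b, C (γ.val a b) * X b) (F j)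

theorem conjForms_one {K : Type*} [Field K] (F : Fin 2 → MvPolynomial (Fin 2) K) :
    conjForms 1 F = F := by
  have h : (fun a : Fin 2 => ∑ b, C ((1 : GL (Fin 2) K).val a b) * X b)
      = (X : Fin 2 → MvPolynomial (Fin 2) K) := by
    funext a
    fin_cases a <;> simp [Fin.sum_univ_two]
  funext i
  simp only [conjForms, h, aeval_X_left, AlgHom.id_apply]
  fin_cases i <;> simp [Fin.sum_univ_two]

theorem conjForms_smul {K : Type*} [Field K] (γ : GL (Fin 2) K) (c : K)
    (F : Fin 2 → MvPolynomial (Fin 2) K) : conjForms γ (c • F) = c • conjForms γ F := by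
  funext i
  simp [conjForms]

theorem conjForms_mul {K : Type*} [Field K] (γ δ : GL (Fin 2) K)
    (F : Fin 2 → MvPolynomial (Fin 2) K) :
    conjForms δ (conjForms γ F) = conjForms (γ * δ) F := by
  have h : ∀ p : MvPolynomial (Fin 2) K,
      aeval (fun a => ∑ b, C (δ.val a b) * X b)
        (aeval (fun a => ∑ b, C (γ.val a b) * (X b : MvPolynomial (Fin 2) K)) p)
      = aeval (fun a => ∑ b, C ((γ * δ).val a b) * (X b : MvPolynomial (Fin 2) K)) p := by
    intro p
    induction p using MvPolynomial.induction_on with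
    | C a => simp [algHom_C]
    | add p q hp hq => simp only [map_add, hp, hq]
    | mul_X p n hp =>
      rw [map_mul, map_mul, hp, map_mul]
      simp only [aeval_X, map_mul, algHom_C, MvPolynomial.algebraMap_eq,
        Fin.sum_univ_two, Units.val_mul, Matrix.mul_apply, map_add]
      ring
  funext i
  have h2 : ((γ * δ)⁻¹).val = (δ⁻¹).val * (γ⁻¹).val := by rw [mul_inv_rev, Units.val_mul]
  simp only [Fin.sum_univ_two] at h
  simp only [conjForms, map_mul, h2, Matrix.mul_apply, Fin.sum_univ_two, map_add, algHom_C,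
    MvPolynomial.algebraMap_eq, h]
  ring

/-- A rational map `[F₀ : F₁]` of degree two on the projective line over `K`, given by two
quadratic forms without common factor. -/
structure QuadMap (K : Type*) [Field K] where
  F : Fin 2 → MvPolynomial (Fin 2) K
  isHomogeneous : ∀ i, (F i).IsHomogeneous 2
  isRelPrime : IsRelPrime (F 0) (F 1)

namespace QuadMap

variable {K : Type*} [Field K]

/-- `ψ = φ^γ = γ⁻¹ ∘ φ ∘ γ` as rational maps: pairs of forms that differ by a nonzero
constant define the same rational map. -/
def IsConjBy (γ : GL (Fin 2) K) (φ ψ : QuadMap K) : Prop :=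
  ∃ c : K, c ≠ 0 ∧ ψ.F = c • conjForms γ φ.F

/-- Two maps are equivalent if they are conjugate under `PGL₂(K)`. -/
instance setoid (K : Type*) [Field K] : Setoid (QuadMap K) where
  r φ ψ := ∃ γ : GL (Fin 2) K, IsConjBy γ φ ψ
  iseqv :=
    { refl := fun φ => ⟨1, 1, one_ne_zero, by rw [conjForms_one, one_smul]⟩
      symm := by
        rintro φ ψ ⟨γ, c, hc, h⟩
        refine ⟨γ⁻¹, c⁻¹, inv_ne_zero hc, ?_⟩
        rw [h, conjForms_smul, conjForms_mul, mul_inv_cancel, conjForms_one, smul_smul,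
          inv_mul_cancel₀ hc, one_smul]
      trans := by
        rintro φ ψ χ ⟨γ, c, hc, h⟩ ⟨δ, d, hd, h'⟩
        refine ⟨γ * δ, d * c, mul_ne_zero hd hc, ?_⟩
        rw [h', h, conjForms_smul, conjForms_mul, smul_smul] }

/-- The automorphism group `{γ ∈ PGL₂(K) | φ^γ = φ}` is trivial, where
`PGL₂(K)` is the quotient of `GL₂(K)` by its centre. -/
def HasTrivialAut (φ : QuadMap K) : Prop :=
  ∀ γ : GL (Fin 2) K, IsConjBy γ φ φ → γ ∈ Subgroup.center (GL (Fin 2) K)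

/-- The map obtained by applying a field automorphism to all coefficients. -/
noncomputable def galois (σ : K ≃+* K) (φ : QuadMap K) : QuadMap K where
  F i := map (σ : K →+* K) (φ.F i)
  isHomogeneous i := (φ.isHomogeneous i).map _
  isRelPrime := by
    intro d h0 h1
    have e : ∀ p : MvPolynomial (Fin 2) K,
        (mapEquiv (Fin 2) σ) p = map (σ : K →+* K) p := fun p => rfl
    rw [← e] at h0 h1
    have h0' := map_dvd (mapEquiv (Fin 2) σ).symm h0
    have h1' := map_dvd (mapEquiv (Fin 2) σ).symm h1
    rw [RingEquiv.symm_apply_apply] at h0' h1'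
    exact (isUnit_map_iff (mapEquiv (Fin 2) σ).symm d).1 (φ.isRelPrime h0' h1')

/-- The map `φ` is given by forms with coefficients in the subfield `k`. -/
def DefinedOver (k : Type*) [Field k] [Algebra k K] (φ : QuadMap K) : Prop :=
  ∀ i, φ.F i ∈ Set.range (map (algebraMap k K) : MvPolynomial (Fin 2) k → _)

/-- The linear form `f` attached to a quadratic map: the divergence `∂F₀/∂X₀ + ∂F₁/∂X₁`. -/
noncomputable def divergence (φ : QuadMap K) : MvPolynomial (Fin 2) K :=
  pderiv 0 (φ.F 0) + pderiv 1 (φ.F 1)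

/-- The cubic form `g` attached to a quadratic map: the fixed point polynomial
`X₁ F₀ - X₀ F₁`. -/
noncomputable def fixedPointPoly (φ : QuadMap K) : MvPolynomial (Fin 2) K :=
  X 1 * φ.F 0 - X 0 * φ.F 1

end QuadMap

theorem conjForms_map {K : Type*} [Field K] (σ : K ≃+* K) (γ : GL (Fin 2) K)
    (F : Fin 2 → MvPolynomial (Fin 2) K) (i : Fin 2) :
    map (σ : K →+* K) (conjForms γ F i)
      = conjForms (Matrix.GeneralLinearGroup.map (σ : K →+* K) γ)
          (fun j => map (σ : K →+* K) (F j)) i := by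
  have h : ∀ p : MvPolynomial (Fin 2) K,
      map (σ : K →+* K) (aeval (fun a => ∑ b, C (γ.val a b) * (X b : MvPolynomial (Fin 2) K)) p)
      = aeval (fun a => ∑ b, C ((Matrix.GeneralLinearGroup.map (σ : K →+* K) γ).val a b)
          * (X b : MvPolynomial (Fin 2) K)) (map (σ : K →+* K) p) := by
    intro p
    induction p using MvPolynomial.induction_on with
    | C a => simp [algHom_C]
    | add p q hp hq => rw [map_add, map_add, hp, hq, map_add, map_add]
    | mul_X p n hp =>
      rw [map_mul, map_mul, hp, map_mul, map_mul]
      simp [Fin.sum_univ_two]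
  have h' : ∀ a b, σ ((γ⁻¹).val a b)
      = ((Matrix.GeneralLinearGroup.map (σ : K →+* K) γ)⁻¹).val a b := by
    intro a b
    rw [← map_inv]
    rfl
  simp only [conjForms, map_sum, map_mul, h, map_C, RingHom.coe_coe, h']

/-- The `K`-points of the moduli space of quadratic rational maps, for `K` algebraically
closed: conjugacy classes of quadratic maps over `K`. -/
def M2 (K : Type*) [Field K] : Type _ := Quotient (QuadMap.setoid K)

/-- The point `[φ]` of the moduli space. -/
def QuadMap.toPoint {K : Type*} [Field K] (φ : QuadMap K) : M2 K := Quotient.mk _ φ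

/-! ### Transvectants and the covariants of a linear and a cubic form -/

section Covariants

variable {K : Type*} [Field K]

/-- The `r`-th transvectant `(F, G)_r` of binary forms of orders `m` and `n`: the normalised
`r`-th iterate of `∂²/∂Z₁∂Y₀ - ∂²/∂Z₀∂Y₁` on `F(Z) G(Y)`, expanded by the binomial theorem,
at `Z = Y = X`. -/
noncomputable def transvectant (m n r : ℕ) (F G : MvPolynomial (Fin 2) K) :
    MvPolynomial (Fin 2) K :=
  C ((((m - r).factorial * (n - r).factorial : ℕ) : K) / ((m.factorial * n.factorial : ℕ) : K)) *
    ∑ j ∈ Finset.range (r + 1), C ((-1 : K) ^ j * (r.choose j : K)) *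
      (((pderiv 0)^[j] ((pderiv 1)^[r - j] F)) * ((pderiv 0)^[r - j] ((pderiv 1)^[j] G)))

/-- `H = (g, g)₂`, of order 2. -/
noncomputable def covH (g : MvPolynomial (Fin 2) K) : MvPolynomial (Fin 2) K :=
  transvectant 3 3 2 g g

/-- `t = (g, H)₁`, of order 3. -/
noncomputable def covT (g : MvPolynomial (Fin 2) K) : MvPolynomial (Fin 2) K :=
  transvectant 3 2 1 g (covH g)

/-- The basic invariants `s₁ = (g, f³)₃`, `s₂ = (H, f²)₂`, `s₃ = (t, g)₃` of degree 4 and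
`r = (t, f³)₃` of degree 6. They are forms of order 0, that is, constants. -/
noncomputable def basicInvariants (f g : MvPolynomial (Fin 2) K) : Fin 4 → K :=
  ![constantCoeff (transvectant 3 3 3 g (f ^ 3)),
    constantCoeff (transvectant 2 2 2 (covH g) (f ^ 2)),
    constantCoeff (transvectant 3 3 3 (covT g) g),
    constantCoeff (transvectant 3 3 3 (covT g) (f ^ 3))]

/-- The linear covariants `V₀ = (H, f)₁` and `V₁ = (g, f²)₂`. -/
noncomputable def covV (f g : MvPolynomial (Fin 2) K) : Fin 2 → MvPolynomial (Fin 2) K :=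
  ![transvectant 2 1 1 (covH g) f, transvectant 3 2 2 g (f ^ 2)]

/-- The invariants `b₀ = (V₁, f)₁` and `b₁ = (V₀, f)₁`. -/
noncomputable def covB (f g : MvPolynomial (Fin 2) K) : Fin 2 → K :=
  ![constantCoeff (transvectant 1 1 1 (covV f g 1) f),
    constantCoeff (transvectant 1 1 1 (covV f g 0) f)]

/-- One factor `(G, V)₁` in a symbolic product of first transvectants of a cubic form with
linear forms `V`, normalised by `1/3`. -/
noncomputable def cubicContract (V G : MvPolynomial (Fin 2) K) : MvPolynomial (Fin 2) K :=
  C (1 / 3 : K) * (pderiv 1 G * pderiv 0 V - pderiv 0 G * pderiv 1 V)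

/-- The invariants `a_{ijk} = (g, V_i)₁ (g, V_j)₁ (g, V_k)₁`, a symbolic product in which the
three differential operators are applied to one copy of the cubic form `g`. -/
noncomputable def covA (f g : MvPolynomial (Fin 2) K) (i j l : Fin 2) : K :=
  constantCoeff
    (cubicContract (covV f g i) (cubicContract (covV f g j) (cubicContract (covV f g l) g)))

end Covariants

namespace QuadMap

variable {K : Type*} [Field K]

/-- The values `(s₁, s₂, s₃, r)` at a quadratic map, through its pair `(f, g)` of forms. -/
noncomputable def invariants (φ : QuadMap K) : Fin 4 → K :=
  basicInvariants φ.divergence φ.fixedPointPoly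

end QuadMap

namespace M2

variable {K : Type*} [Field K]

/-- The action of a field automorphism on points of the moduli space. -/
noncomputable def galois (σ : K ≃+* K) : M2 K → M2 K :=
  Quotient.map (QuadMap.galois σ) (by
    rintro φ ψ ⟨γ, c, hc, h⟩
    refine ⟨Matrix.GeneralLinearGroup.map (σ : K →+* K) γ, σ c, by simpa using hc, ?_⟩
    funext i
    have h1 := congrArg (map (σ : K →+* K)) (congrFun h i)
    rw [Pi.smul_apply, smul_eq_C_mul, map_mul, map_C, conjForms_map] at h1
    rw [Pi.smul_apply, smul_eq_C_mul]
    exact h1)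

/-- `P` is a `k`-point, for `K` an algebraic closure of the perfect field `k`: it is fixed by
the Galois group of `K` over `k`. -/
def IsRationalOver (k : Type*) [Field k] [Algebra k K] (P : M2 K) : Prop :=
  ∀ σ : K ≃ₐ[k] K, galois (σ : K ≃+* K) P = P

/-- `P` is the class of maps with trivial automorphism group. -/
def HasTrivialAut (P : M2 K) : Prop :=
  ∀ φ : QuadMap K, φ.toPoint = P → φ.HasTrivialAut

/-- `x` is a tuple of coordinates for `P` in the weighted projective space `ℙ(4, 4, 4, 6)`, in
which the coordinates of `[φ]` are the invariants `s₁, s₂, s₃, r` of `φ`. -/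
def IsWeightedCoords (P : M2 K) (x : Fin 4 → K) : Prop :=
  ∃ φ : QuadMap K, φ.toPoint = P ∧
    ∃ α : K, α ≠ 0 ∧ ∀ i, x i = α ^ (![4, 4, 4, 6] i : ℕ) * φ.invariants i

end M2

/-! ### The explicit model -/

section Model

variable {k : Type*} [Field k]

/-- `b₀, b₁` in terms of the basic invariants. -/
def bVal (s₁ s₂ : k) : Fin 2 → k := ![s₁, s₂]

/-- `a_{ijk}` in terms of the basic invariants; symmetric in the indices, with
`a₀₀₀ = s₃ r / 9`, `a₁₀₀ = 0`, `a₁₁₀ = - s₂ r / 9`, `a₁₁₁ = - 2 s₁ r / 9`. -/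
def aVal (s₁ s₂ s₃ r : k) (i j l : Fin 2) : k :=
  ![s₃ * r / 9, 0, -(s₂ * r) / 9, -(2 * s₁ * r) / 9]
    (⟨i.val + j.val + l.val, by omega⟩ : Fin 4)

/-- The linear forms `W₀, W₁` with `W_i = N_{i0} X₀ + N_{i1} X₁`. -/
noncomputable def linearForms (N : Matrix.SpecialLinearGroup (Fin 2) k) (i : Fin 2) :
    MvPolynomial (Fin 2) k :=
  ∑ j, C (N.val i j) * X j

/-- `f = b₀ W₀ - b₁ W₁`. -/
noncomputable def modelLinear (s₁ s₂ : k) (W : Fin 2 → MvPolynomial (Fin 2) k) :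
    MvPolynomial (Fin 2) k :=
  C (bVal s₁ s₂ 0) * W 0 - C (bVal s₁ s₂ 1) * W 1

/-- `g = 9/(2r) ∑ (-1)^(i+j+l) a_{ijl} W_{i+1} W_{j+1} W_{l+1}`, indices modulo 2. -/
noncomputable def modelCubic (s₁ s₂ s₃ r : k) (W : Fin 2 → MvPolynomial (Fin 2) k) :
    MvPolynomial (Fin 2) k :=
  C (9 / (2 * r)) * ∑ i : Fin 2, ∑ j : Fin 2, ∑ l : Fin 2,
    C ((-1 : k) ^ (i.val + j.val + l.val) * aVal s₁ s₂ s₃ r i j l) *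
      (W (i + 1) * W (j + 1) * W (l + 1))

end Model

/-!
A quadratic map is determined by its pair `(f, g)`, since `3F₀ = ∂g/∂X₁ + X₀ f` and
`3F₁ = X₁ f - ∂g/∂X₀`, and replacing the map by `c φ^γ` replaces the pair by
`(c f ∘ γ, c det(γ)⁻¹ g ∘ γ)`. All covariants are therefore computed for an explicit linear form
and an explicit cubic form; in these coordinates the formulas for `b_i` and `a_{ijl}` are
polynomial identities (`covB_forms`, `covA_forms`).

The linear covariants `V₀, V₁` have determinant `r` (`det_covVMatrix`). Where `r ≠ 0` they form a
basis, and Cramer's rule gives `r f = b₀V₀ - b₁V₁` and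
`r³ g = 9/2 ∑ (-1)^(i+j+l) a_{ijl} V_{i+1} V_{j+1} V_{l+1}` (`modelLinear_covV`,
`modelCubic_covV`). The linear substitution `γ` that takes `V₀, V₁` to given `W₀, W₁` of
determinant one has determinant `r⁻¹`, and the pair of `r φ^γ` is exactly the model
(`QuadMap.exists_conj_eq_model`). That pair has coefficients in `k`, hence so does the map.

It remains to see that `r ≠ 0`. Up to sign, `r` is the value of `t` at the root of `f`. If it
vanishes, there is a point `q` with `f(q) = t(q) = 0`, and the identity `cubic_syzygy` shows that
either `g` has a multiple zero at `q`, which makes `q` a common zero of `F₀` and `F₁`, or the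
involution fixing `q` and the zero of `x ↦ g(q, q, x)` preserves `g` and changes the sign of `f`,
which makes it a nontrivial automorphism (`QuadMap.not_hasTrivialAut_of_common_zero`). Scaling a
representative of the class by `α` multiplies the invariants by the weighted powers of `α`, so
some representative has the prescribed invariants.
-/

/-! ### Binary forms of order at most three -/

section BinaryForms

variable {K : Type*} [Field K]

/-- The linear form `a X₀ + b X₁`. -/
noncomputable def linForm (a b : K) : MvPolynomial (Fin 2) K := C a * X 0 + C b * X 1

/-- The quadratic form `a X₀² + b X₀X₁ + c X₁²`, without binomial coefficients. -/
noncomputable def quadForm (a b c : K) : MvPolynomial (Fin 2) K :=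
  C a * X 0 ^ 2 + C b * (X 0 * X 1) + C c * X 1 ^ 2

/-- The cubic form `a X₀³ + 3b X₀²X₁ + 3c X₀X₁² + d X₁³`, with binomial coefficients. -/
noncomputable def cubForm (a b c d : K) : MvPolynomial (Fin 2) K :=
  C a * X 0 ^ 3 + 3 * C b * (X 0 ^ 2 * X 1) + 3 * C c * (X 0 * X 1 ^ 2) + C d * X 1 ^ 3

theorem linForm_sq (a b : K) : linForm a b ^ 2 = quadForm (a ^ 2) (2 * a * b) (b ^ 2) := by
  simp only [linForm, quadForm, map_mul, map_pow, map_ofNat]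
  ring

theorem linForm_cube (a b : K) :
    linForm a b ^ 3 = cubForm (a ^ 3) (a ^ 2 * b) (a * b ^ 2) (b ^ 3) := by
  simp only [linForm, cubForm, map_mul, map_pow]
  ring

@[simp]
theorem pderiv_zero_linForm (a b : K) : pderiv 0 (linForm a b) = C a := by
  simp [linForm]

@[simp]
theorem pderiv_one_linForm (a b : K) : pderiv 1 (linForm a b) = C b := by
  simp [linForm]

@[simp]
theorem pderiv_zero_quadForm (a b c : K) : pderiv 0 (quadForm a b c) = linForm (2 * a) b := by
  simp [quadForm, linForm, map_ofNat (C : K →+* MvPolynomial (Fin 2) K)]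
  ring

@[simp]
theorem pderiv_one_quadForm (a b c : K) : pderiv 1 (quadForm a b c) = linForm b (2 * c) := by
  simp [quadForm, linForm, map_ofNat (C : K →+* MvPolynomial (Fin 2) K)]
  ring

@[simp]
theorem pderiv_zero_cubForm (a b c d : K) :
    pderiv 0 (cubForm a b c d) = quadForm (3 * a) (6 * b) (3 * c) := by
  have h : pderiv 0 (3 : MvPolynomial (Fin 2) K) = 0 := pderiv_C (R := K) (a := 3)
  simp [cubForm, quadForm, h, map_ofNat (C : K →+* MvPolynomial (Fin 2) K)]
  ring

@[simp]
theorem pderiv_one_cubForm (a b c d : K) :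
    pderiv 1 (cubForm a b c d) = quadForm (3 * b) (6 * c) (3 * d) := by
  have h : pderiv 1 (3 : MvPolynomial (Fin 2) K) = 0 := pderiv_C (R := K) (a := 3)
  simp [cubForm, quadForm, h, map_ofNat (C : K →+* MvPolynomial (Fin 2) K)]
  ring

variable [CharZero K]

theorem transvectant_cubForm_cubForm_two (a b c d a' b' c' d' : K) :
    transvectant 3 3 2 (cubForm a b c d) (cubForm a' b' c' d') =
      quadForm (a * c' - 2 * b * b' + c * a') (a * d' - b * c' - c * b' + d * a')
        (b * d' - 2 * c * c' + d * b') := by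
  refine MvPolynomial.funext fun x => ?_
  simp [transvectant, Finset.sum_range_succ, Nat.factorial]
  simp [linForm, quadForm]
  ring

theorem transvectant_cubForm_quadForm_one (a b c d a' b' c' : K) :
    transvectant 3 2 1 (cubForm a b c d) (quadForm a' b' c') =
      cubForm (b * a' - a * b' / 2) ((4 * c * a' - b * b' - 2 * a * c') / 6)
        ((2 * d * a' + c * b' - 4 * b * c') / 6) (d * b' / 2 - c * c') := by
  refine MvPolynomial.funext fun x => ?_
  simp [transvectant, Finset.sum_range_succ, Nat.factorial]
  simp [linForm, quadForm, cubForm]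
  ring

theorem transvectant_cubForm_cubForm_three (a b c d a' b' c' d' : K) :
    transvectant 3 3 3 (cubForm a b c d) (cubForm a' b' c' d') =
      C (d * a' - 3 * c * b' + 3 * b * c' - a * d') := by
  refine MvPolynomial.funext fun x => ?_
  simp [transvectant, Finset.sum_range_succ, Nat.factorial]
  ring

theorem transvectant_quadForm_quadForm_two (a b c a' b' c' : K) :
    transvectant 2 2 2 (quadForm a b c) (quadForm a' b' c') =
      C (c * a' - b * b' / 2 + a * c') := by
  refine MvPolynomial.funext fun x => ?_
  simp [transvectant, Finset.sum_range_succ, Nat.factorial]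
  ring

theorem transvectant_quadForm_linForm_one (a b c a' b' : K) :
    transvectant 2 1 1 (quadForm a b c) (linForm a' b') =
      linForm (b * a' / 2 - a * b') (c * a' - b * b' / 2) := by
  refine MvPolynomial.funext fun x => ?_
  simp [transvectant, Finset.sum_range_succ, Nat.factorial]
  simp [linForm]
  ring

theorem transvectant_cubForm_quadForm_two (a b c d a' b' c' : K) :
    transvectant 3 2 2 (cubForm a b c d) (quadForm a' b' c') =
      linForm (c * a' - b * b' + a * c') (d * a' - c * b' + b * c') := by
  refine MvPolynomial.funext fun x => ?_
  simp [transvectant, Finset.sum_range_succ, Nat.factorial]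
  simp [linForm]
  ring

theorem transvectant_linForm_linForm_one (a b a' b' : K) :
    transvectant 1 1 1 (linForm a b) (linForm a' b') = C (b * a' - a * b') := by
  refine MvPolynomial.funext fun x => ?_
  simp [transvectant, Finset.sum_range_succ, Nat.factorial]
  ring

theorem cubicContract_cubForm (p q a b c d : K) :
    cubicContract (linForm p q) (cubForm a b c d) =
      quadForm (b * p - a * q) (2 * (c * p - b * q)) (d * p - c * q) := by
  refine MvPolynomial.funext fun x => ?_
  simp [cubicContract, quadForm]
  ring

theorem cubicContract_quadForm (p q a b c : K) :
    cubicContract (linForm p q) (quadForm a b c) =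
      linForm ((b * p - 2 * a * q) / 3) ((2 * c * p - b * q) / 3) := by
  refine MvPolynomial.funext fun x => ?_
  simp [cubicContract, linForm]
  ring

theorem cubicContract_linForm (p q a b : K) :
    cubicContract (linForm p q) (linForm a b) = C ((b * p - a * q) / 3) := by
  simp only [cubicContract, pderiv_zero_linForm, pderiv_one_linForm, ← map_mul, ← map_sub]
  congr 1
  ring

end BinaryForms

/-! ### The covariants in coordinates -/

section ExplicitCovariants

variable {K : Type*} [Field K] [CharZero K]

theorem covH_cubForm (a b c d : K) :
    covH (cubForm a b c d) =
      quadForm (2 * (a * c - b ^ 2)) (2 * (a * d - b * c)) (2 * (b * d - c ^ 2)) := by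
  rw [covH, transvectant_cubForm_cubForm_two]
  congr 1 <;> ring

theorem covT_cubForm (a b c d : K) :
    covT (cubForm a b c d) =
      cubForm (3 * a * b * c - 2 * b ^ 3 - a ^ 2 * d) (2 * a * c ^ 2 - b ^ 2 * c - a * b * d)
        (a * c * d + b * c ^ 2 - 2 * b ^ 2 * d) (a * d ^ 2 - 3 * b * c * d + 2 * c ^ 3) := by
  rw [covT, covH_cubForm, transvectant_cubForm_quadForm_one]
  congr 1 <;> ring

theorem basicInvariants_forms (p q a b c d : K) :
    basicInvariants (linForm p q) (cubForm a b c d) =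
      ![d * p ^ 3 - 3 * c * p ^ 2 * q + 3 * b * p * q ^ 2 - a * q ^ 3,
        2 * ((b * d - c ^ 2) * p ^ 2 - (a * d - b * c) * p * q + (a * c - b ^ 2) * q ^ 2),
        -2 * (6 * a * b * c * d + 3 * b ^ 2 * c ^ 2 - 4 * a * c ^ 3 - 4 * b ^ 3 * d
          - a ^ 2 * d ^ 2),
        (a * d ^ 2 - 3 * b * c * d + 2 * c ^ 3) * p ^ 3
          - 3 * (a * c * d + b * c ^ 2 - 2 * b ^ 2 * d) * p ^ 2 * q
          + 3 * (2 * a * c ^ 2 - b ^ 2 * c - a * b * d) * p * q ^ 2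
          - (3 * a * b * c - 2 * b ^ 3 - a ^ 2 * d) * q ^ 3] := by
  rw [basicInvariants, covT_cubForm, covH_cubForm, linForm_cube, linForm_sq,
    transvectant_cubForm_cubForm_three, transvectant_cubForm_cubForm_three,
    transvectant_cubForm_cubForm_three, transvectant_quadForm_quadForm_two]
  simp only [constantCoeff_C]
  congr 1
  · ring
  congr 1
  · ring
  congr 1
  · ring
  congr 1
  ring

theorem covV_forms (p q a b c d : K) :
    covV (linForm p q) (cubForm a b c d) =
      ![linForm ((a * d - b * c) * p - 2 * (a * c - b ^ 2) * q)
          (2 * (b * d - c ^ 2) * p - (a * d - b * c) * q),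
        linForm (c * p ^ 2 - 2 * b * p * q + a * q ^ 2)
          (d * p ^ 2 - 2 * c * p * q + b * q ^ 2)] := by
  rw [covV, covH_cubForm, linForm_sq, transvectant_quadForm_linForm_one,
    transvectant_cubForm_quadForm_two]
  congr 1
  · congr 1 <;> ring
  congr 1
  congr 1 <;> ring

/-- The invariants have degree four, respectively six, in the pair `(f, g)`. -/
theorem basicInvariants_C_mul (e p q a b c d : K) (i : Fin 4) :
    basicInvariants (C e * linForm p q) (C e * cubForm a b c d) i =
      e ^ (![4, 4, 4, 6] i : ℕ) * basicInvariants (linForm p q) (cubForm a b c d) i := by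
  have h1 : C e * linForm p q = linForm (e * p) (e * q) := by
    simp only [linForm, map_mul]
    ring
  have h2 : C e * cubForm a b c d = cubForm (e * a) (e * b) (e * c) (e * d) := by
    simp only [cubForm, map_mul]
    ring
  rw [h1, h2, basicInvariants_forms, basicInvariants_forms]
  fin_cases i <;> simp <;> ring

theorem covB_forms (p q a b c d : K) (i : Fin 2) :
    covB (linForm p q) (cubForm a b c d) i =
      bVal (basicInvariants (linForm p q) (cubForm a b c d) 0)
        (basicInvariants (linForm p q) (cubForm a b c d) 1) i := by
  rw [covB, covV_forms, basicInvariants_forms, bVal]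
  fin_cases i <;> simp [transvectant_linForm_linForm_one] <;> ring

/-- `a_{ijl}` is `2/9` times the value of the symmetric trilinear form of `g` at the zeros
`(-V_{i1}, V_{i0})` of the linear covariants. -/
theorem covA_linForm (f : MvPolynomial (Fin 2) K) {V : Fin 2 → K × K} {a b c d : K}
    (hV : ∀ i, covV f (cubForm a b c d) i = linForm (V i).1 (V i).2) (i j l : Fin 2) :
    covA f (cubForm a b c d) i j l = 2 / 9 * (d * (V i).1 * (V j).1 * (V l).1
      - c * ((V i).2 * (V j).1 * (V l).1 + (V i).1 * (V j).2 * (V l).1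
        + (V i).1 * (V j).1 * (V l).2)
      + b * ((V i).1 * (V j).2 * (V l).2 + (V i).2 * (V j).1 * (V l).2
        + (V i).2 * (V j).2 * (V l).1)
      - a * (V i).2 * (V j).2 * (V l).2) := by
  rw [covA, hV, hV, hV, cubicContract_cubForm, cubicContract_quadForm, cubicContract_linForm,
    constantCoeff_C]
  ring

theorem covA_forms (p q a b c d : K) (i j l : Fin 2) :
    covA (linForm p q) (cubForm a b c d) i j l =
      aVal (basicInvariants (linForm p q) (cubForm a b c d) 0)
        (basicInvariants (linForm p q) (cubForm a b c d) 1)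
        (basicInvariants (linForm p q) (cubForm a b c d) 2)
        (basicInvariants (linForm p q) (cubForm a b c d) 3) i j l := by
  have hV := covV_forms p q a b c d
  rw [covA_linForm (V := ![(_, _), (_, _)]) _ (by rw [hV]; intro i; fin_cases i <;> rfl), aVal,
    basicInvariants_forms]
  fin_cases i <;> fin_cases j <;> fin_cases l <;> simp <;> ring

/-- The matrix of coefficients of the linear covariants `V₀, V₁`. -/
noncomputable def covVMatrix (p q a b c d : K) : Matrix (Fin 2) (Fin 2) K :=
  !![(a * d - b * c) * p - 2 * (a * c - b ^ 2) * q,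
      2 * (b * d - c ^ 2) * p - (a * d - b * c) * q;
    c * p ^ 2 - 2 * b * p * q + a * q ^ 2, d * p ^ 2 - 2 * c * p * q + b * q ^ 2]

/-- The linear covariants `V₀, V₁` are independent exactly where `r` does not vanish. -/
theorem det_covVMatrix (p q a b c d : K) :
    (covVMatrix p q a b c d).det = basicInvariants (linForm p q) (cubForm a b c d) 3 := by
  rw [basicInvariants_forms, covVMatrix, Matrix.det_fin_two_of]
  simp
  ring

end ExplicitCovariants


/-! ### Recovering `f` and `g` from the linear covariants -/

section Reconstruction

variable {K : Type*} [Field K] [CharZero K]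

/-- Cramer's rule for the dual basis of two linear forms: a cubic form is recovered from its
contractions with two independent linear forms. -/
theorem cubForm_eq_sum_contractions (V : Fin 2 → K × K) (A : Fin 2 → Fin 2 → Fin 2 → K)
    (a b c d : K)
    (hA : ∀ i j l, A i j l = 2 / 9 * (d * (V i).1 * (V j).1 * (V l).1
      - c * ((V i).2 * (V j).1 * (V l).1 + (V i).1 * (V j).2 * (V l).1
        + (V i).1 * (V j).1 * (V l).2)
      + b * ((V i).1 * (V j).2 * (V l).2 + (V i).2 * (V j).1 * (V l).2
        + (V i).2 * (V j).2 * (V l).1)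
      - a * (V i).2 * (V j).2 * (V l).2)) :
    ∑ i : Fin 2, ∑ j : Fin 2, ∑ l : Fin 2, C ((-1 : K) ^ (i.val + j.val + l.val) * A i j l) *
      (linForm (V (i + 1)).1 (V (i + 1)).2 * linForm (V (j + 1)).1 (V (j + 1)).2 *
        linForm (V (l + 1)).1 (V (l + 1)).2) =
    C (2 / 9 * ((V 0).1 * (V 1).2 - (V 0).2 * (V 1).1) ^ 3) * cubForm a b c d := by
  simp only [hA, Fin.sum_univ_two, Fin.isValue, zero_add, show (1 + 1 : Fin 2) = 0 from rfl]
  refine MvPolynomial.funext fun x => ?_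
  simp [linForm, cubForm]
  ring

/-- Substituting the linear covariants `V₀, V₁` for `W₀, W₁` in the model returns `f`, up to the
factor `r`. -/
theorem modelLinear_covV (p q a b c d s₁ s₂ r : K)
    (h₁ : basicInvariants (linForm p q) (cubForm a b c d) 0 = s₁)
    (h₂ : basicInvariants (linForm p q) (cubForm a b c d) 1 = s₂)
    (hr : basicInvariants (linForm p q) (cubForm a b c d) 3 = r) :
    modelLinear s₁ s₂ (covV (linForm p q) (cubForm a b c d)) = C r * linForm p q := by
  rw [← h₁, ← h₂, ← hr, covV_forms, basicInvariants_forms, modelLinear, bVal]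
  refine MvPolynomial.funext fun x => ?_
  simp [linForm]
  ring

/-- Substituting `V₀, V₁` for `W₀, W₁` in the model returns `g`, up to the factor `r²`. -/
theorem modelCubic_covV (p q a b c d s₁ s₂ s₃ r : K)
    (h₁ : basicInvariants (linForm p q) (cubForm a b c d) 0 = s₁)
    (h₂ : basicInvariants (linForm p q) (cubForm a b c d) 1 = s₂)
    (h₃ : basicInvariants (linForm p q) (cubForm a b c d) 2 = s₃)
    (hr : basicInvariants (linForm p q) (cubForm a b c d) 3 = r) (hr0 : r ≠ 0) :
    modelCubic s₁ s₂ s₃ r (covV (linForm p q) (cubForm a b c d)) =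
      C (r ^ 2) * cubForm a b c d := by
  set M := covVMatrix p q a b c d with hM
  have hV : ∀ i, covV (linForm p q) (cubForm a b c d) i = linForm (M i 0) (M i 1) := by
    intro i
    rw [covV_forms, hM, covVMatrix]
    fin_cases i <;> rfl
  have hA := covA_linForm (linForm p q) (V := fun i => (M i 0, M i 1)) hV
  have key := cubForm_eq_sum_contractions (fun i => (M i 0, M i 1)) _ a b c d hA
  have hdet : M 0 0 * M 1 1 - M 0 1 * M 1 0 = r := by
    rw [← Matrix.det_fin_two, hM, det_covVMatrix, hr]
  simp only [covA_forms, h₁, h₂, h₃, hr, hdet] at key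
  rw [modelCubic]
  simp only [hV]
  rw [key, ← mul_assoc, ← map_mul]
  congr 2
  field_simp

end Reconstruction

/-! ### Conjugation of quadratic maps -/

section LinearSubstitution

variable {K : Type*} [Field K]

/-- The substitution `X_i ↦ A_{i0} X₀ + A_{i1} X₁`, that is, `p ↦ p ∘ A`. -/
noncomputable def linSubst (A : Matrix (Fin 2) (Fin 2) K) :
    MvPolynomial (Fin 2) K →ₐ[K] MvPolynomial (Fin 2) K :=
  aeval fun a => ∑ b, C (A a b) * X b

theorem linSubst_X (A : Matrix (Fin 2) (Fin 2) K) (i : Fin 2) :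
    linSubst A (X i) = C (A i 0) * X 0 + C (A i 1) * X 1 := by
  simp [linSubst, Fin.sum_univ_two]

theorem linSubst_C (A : Matrix (Fin 2) (Fin 2) K) (c : K) : linSubst A (C c) = C c :=
  algHom_C _ c

theorem linSubst_linForm (A : Matrix (Fin 2) (Fin 2) K) (p q : K) :
    linSubst A (linForm p q) =
      linForm (p * A 0 0 + q * A 1 0) (p * A 0 1 + q * A 1 1) := by
  simp only [linForm, map_add, map_mul, linSubst_C, linSubst_X]
  ring

theorem linSubst_linSubst (A B : Matrix (Fin 2) (Fin 2) K) (p : MvPolynomial (Fin 2) K) :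
    linSubst B (linSubst A p) = linSubst (A * B) p := by
  have h : (linSubst B).comp (linSubst A) = linSubst (A * B) := by
    refine algHom_ext fun i => ?_
    rw [AlgHom.comp_apply, linSubst_X, map_add, map_mul, map_mul, linSubst_C, linSubst_C,
      linSubst_X, linSubst_X, linSubst_X]
    simp only [Matrix.mul_apply, Fin.sum_univ_two, map_add, map_mul]
    ring
  exact DFunLike.congr_fun h p

theorem linSubst_one (p : MvPolynomial (Fin 2) K) : linSubst 1 p = p := by
  have h : linSubst (1 : Matrix (Fin 2) (Fin 2) K) = AlgHom.id K _ := by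
    refine algHom_ext fun i => ?_
    rw [linSubst_X]
    fin_cases i <;> simp [Matrix.one_apply]
  rw [h, AlgHom.id_apply]

/-- The chain rule for linear substitutions. -/
theorem pderiv_linSubst (A : Matrix (Fin 2) (Fin 2) K) (j : Fin 2) (p : MvPolynomial (Fin 2) K) :
    pderiv j (linSubst A p) =
      C (A 0 j) * linSubst A (pderiv 0 p) + C (A 1 j) * linSubst A (pderiv 1 p) := by
  induction p using MvPolynomial.induction_on with
  | C a => simp
  | add p q hp hq =>
    simp only [map_add, hp, hq]
    ring
  | mul_X p n hp =>
    have hX : pderiv j (linSubst A (X n)) = C (A n j) := by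
      rw [linSubst_X]
      fin_cases j <;> simp
    have hn : ∀ i : Fin 2, linSubst A (pderiv i (X n)) = if n = i then 1 else 0 := by
      intro i
      rw [pderiv_X, Pi.single_apply]
      split_ifs <;> simp
    rw [map_mul, pderiv_mul, pderiv_mul, pderiv_mul, hp, hX]
    simp only [map_add, map_mul, hn]
    fin_cases n <;> simp <;> ring

theorem conjForms_apply (γ : GL (Fin 2) K) (F : Fin 2 → MvPolynomial (Fin 2) K) (i : Fin 2) :
    conjForms γ F i =
      C ((γ⁻¹).val i 0) * linSubst γ.val (F 0) + C ((γ⁻¹).val i 1) * linSubst γ.val (F 1) := by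
  rw [conjForms, Fin.sum_univ_two]
  rfl

theorem isHomogeneous_conjForms (γ : GL (Fin 2) K) {F : Fin 2 → MvPolynomial (Fin 2) K} {n : ℕ}
    (hF : ∀ i, (F i).IsHomogeneous n) (i : Fin 2) : (conjForms γ F i).IsHomogeneous n := by
  refine IsHomogeneous.sum _ _ _ fun j _ => IsHomogeneous.C_mul ?_ _
  have := (hF j).aeval (fun a => ∑ b, C (γ.val a b) * (X b : MvPolynomial (Fin 2) K))
    (n := 1) fun a => IsHomogeneous.sum _ _ _ fun b _ => (isHomogeneous_X K b).C_mul _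
  rwa [one_mul] at this

theorem isRelPrime_conjForms (γ : GL (Fin 2) K) {F : Fin 2 → MvPolynomial (Fin 2) K}
    (hF : IsRelPrime (F 0) (F 1)) : IsRelPrime (conjForms γ F 0) (conjForms γ F 1) := by
  intro e h0 h1
  have hdvd : ∀ i, linSubst (γ⁻¹).val e ∣ F i := by
    intro i
    have h := congrFun (conjForms_mul γ γ⁻¹ F) i
    rw [mul_inv_cancel, conjForms_one, conjForms_apply] at h
    rw [← h]
    exact dvd_add ((map_dvd _ h0).mul_left _) ((map_dvd _ h1).mul_left _)
  have hu := (hF (hdvd 0) (hdvd 1)).map (linSubst γ.val)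
  rwa [linSubst_linSubst, ← Units.val_mul, inv_mul_cancel, Units.val_one, linSubst_one] at hu

theorem GL_fin_two_inv_val (γ : GL (Fin 2) K) :
    (γ⁻¹).val = (γ.val.det)⁻¹ • !![γ.val 1 1, -γ.val 0 1; -γ.val 1 0, γ.val 0 0] := by
  rw [Matrix.coe_units_inv, Matrix.inv_def, Ring.inverse_eq_inv', Matrix.adjugate_fin_two]

end LinearSubstitution

namespace QuadMap

variable {K : Type*} [Field K]

/-- The representative `c · (γ⁻¹ ∘ φ ∘ γ)` of the conjugate of `φ` by `γ`. -/
noncomputable def conj (φ : QuadMap K) (γ : GL (Fin 2) K) (c : K) (hc : c ≠ 0) : QuadMap K where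
  F := c • conjForms γ φ.F
  isHomogeneous i := by
    rw [Pi.smul_apply, smul_eq_C_mul]
    exact (isHomogeneous_conjForms γ φ.isHomogeneous i).C_mul c
  isRelPrime := by
    have hu : IsUnit (C c : MvPolynomial (Fin 2) K) := (isUnit_iff_ne_zero.2 hc).map C
    simp only [Pi.smul_apply, smul_eq_C_mul]
    exact (isRelPrime_mul_unit_left hu).2 (isRelPrime_conjForms γ φ.isRelPrime)

theorem toPoint_conj (φ : QuadMap K) (γ : GL (Fin 2) K) (c : K) (hc : c ≠ 0) :
    (φ.conj γ c hc).toPoint = φ.toPoint :=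
  (Quotient.sound ⟨γ, c, hc, rfl⟩ : φ.toPoint = (φ.conj γ c hc).toPoint).symm

/-- The pair `(f, g)` of `c φ^γ` is `(c f ∘ γ, c det(γ)⁻¹ g ∘ γ)`: this is the linear part. -/
theorem divergence_conj (φ : QuadMap K) (γ : GL (Fin 2) K) (c : K) (hc : c ≠ 0) :
    (φ.conj γ c hc).divergence = C c * linSubst γ.val φ.divergence := by
  have e : ∀ i j, C (γ.val i 0) * C ((γ⁻¹).val 0 j) + C (γ.val i 1) * C ((γ⁻¹).val 1 j) =
      (C ((1 : Matrix (Fin 2) (Fin 2) K) i j) : MvPolynomial (Fin 2) K) := by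
    intro i j
    have hm : γ.val * (γ⁻¹).val = 1 := by
      rw [← Units.val_mul, mul_inv_cancel, Units.val_one]
    rw [← hm, Matrix.mul_apply, Fin.sum_univ_two, map_add, map_mul, map_mul]
  have e00 := e 0 0
  have e01 := e 0 1
  have e10 := e 1 0
  have e11 := e 1 1
  simp only [Matrix.one_apply_eq, ne_eq, one_ne_zero, zero_ne_one, not_false_eq_true,
    Matrix.one_apply_ne, map_one, map_zero, Fin.isValue] at e00 e01 e10 e11
  simp only [divergence, conj, Pi.smul_apply, smul_eq_C_mul, pderiv_C_mul, conjForms_apply,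
    map_add, pderiv_linSubst]
  linear_combination C c * (linSubst γ.val (pderiv 0 (φ.F 0)) * e00
    + linSubst γ.val (pderiv 0 (φ.F 1)) * e01 + linSubst γ.val (pderiv 1 (φ.F 0)) * e10
    + linSubst γ.val (pderiv 1 (φ.F 1)) * e11)

theorem fixedPointPoly_conj (φ : QuadMap K) (γ : GL (Fin 2) K) (c : K) (hc : c ≠ 0) :
    (φ.conj γ c hc).fixedPointPoly =
      C (c * (γ.val.det)⁻¹) * linSubst γ.val φ.fixedPointPoly := by
  simp only [fixedPointPoly, conj, Pi.smul_apply, smul_eq_C_mul, conjForms_apply,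
    GL_fin_two_inv_val, map_sub, map_mul, linSubst_X]
  simp
  ring

end QuadMap

/-! ### Quadratic maps and their pairs `(f, g)` -/

section Coordinates

variable {K : Type*} [Field K]

theorem exists_eq_quadForm {p : MvPolynomial (Fin 2) K} (hp : p.IsHomogeneous 2) :
    ∃ a b c, p = quadForm a b c := by
  rw [p.as_sum]
  refine Finset.sum_induction _ (fun q => ∃ a b c, q = quadForm a b c) ?_ ?_ ?_
  · rintro _ _ ⟨a, b, c, rfl⟩ ⟨a', b', c', rfl⟩
    refine ⟨a + a', b + b', c + c', ?_⟩
    simp only [quadForm, map_add]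
    ring
  · exact ⟨0, 0, 0, by simp [quadForm]⟩
  · intro m hm
    have hdeg : m 0 + m 1 = 2 := by
      have h := hp (mem_support_iff.1 hm)
      rwa [Pi.one_def, ← Finsupp.degree_eq_weight_one, Finsupp.degree_eq_sum, Fin.sum_univ_two] at h
    have hmon : monomial m (coeff m p) = C (coeff m p) * (X 0 ^ m 0 * X 1 ^ m 1) := by
      rw [monomial_eq, Finsupp.prod_fintype _ _ (by simp), Fin.prod_univ_two]
    rw [hmon]
    generalize coeff m p = e
    obtain ⟨h0, h1⟩ | ⟨h0, h1⟩ | ⟨h0, h1⟩ :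
        (m 0 = 0 ∧ m 1 = 2) ∨ (m 0 = 1 ∧ m 1 = 1) ∨ (m 0 = 2 ∧ m 1 = 0) := by omega
    · exact ⟨0, 0, e, by simp [quadForm, h0, h1]⟩
    · exact ⟨0, e, 0, by simp [quadForm, h0, h1]⟩
    · exact ⟨e, 0, 0, by simp [quadForm, h0, h1]⟩

/-- A zero `(u : v)` of a quadratic form splits off the linear factor `v X₀ - u X₁`. -/
theorem linForm_dvd_quadForm {u v a b c : K} (huv : u ≠ 0 ∨ v ≠ 0)
    (h : a * u ^ 2 + b * (u * v) + c * v ^ 2 = 0) : linForm v (-u) ∣ quadForm a b c := by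
  have key : ∀ α β : K, α * v = a → β * v - α * u = b → -u * β = c →
      linForm v (-u) ∣ quadForm a b c := by
    rintro α β rfl rfl rfl
    refine ⟨linForm α β, ?_⟩
    simp only [linForm, quadForm, map_mul, map_sub, map_neg]
    ring
  rcases huv with hu | hv
  · refine key (-(c * v + b * u) / u ^ 2) (-c / u) ?_ ?_ ?_
    · field_simp
      linear_combination -h
    · field_simp
      ring
    · field_simp
  · refine key (a / v) ((b * v + a * u) / v ^ 2) ?_ ?_ ?_
    · field_simp
    · field_simp
      ring
    · field_simp
      linear_combination -h

end Coordinates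

namespace QuadMap

variable {K : Type*} [Field K]

/-- The two forms of a quadratic map have no common zero on the projective line. -/
theorem not_common_zero (φ : QuadMap K) {u v : K} (huv : u ≠ 0 ∨ v ≠ 0)
    (h : ∀ i, eval ![u, v] (φ.F i) = 0) : False := by
  have hdvd : ∀ i, linForm v (-u) ∣ φ.F i := by
    intro i
    obtain ⟨a, b, c, hF⟩ := exists_eq_quadForm (φ.isHomogeneous i)
    rw [hF]
    refine linForm_dvd_quadForm huv ?_
    have := h i
    rw [hF] at this
    simpa [quadForm] using this
  have hu := (φ.isRelPrime (hdvd 0) (hdvd 1)).map (eval ![u, v])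
  have h0 : eval ![u, v] (linForm v (-u)) = 0 := by
    simp [linForm]
    ring
  rw [h0] at hu
  exact not_isUnit_zero hu

variable [CharZero K]

theorem exists_coordinates (φ : QuadMap K) :
    ∃ p q a b c d, φ.divergence = linForm p q ∧ φ.fixedPointPoly = cubForm a b c d := by
  obtain ⟨a, b, c, h0⟩ := exists_eq_quadForm (φ.isHomogeneous 0)
  obtain ⟨a', b', c', h1⟩ := exists_eq_quadForm (φ.isHomogeneous 1)
  refine ⟨2 * a + b', b + 2 * c', -a', (a - b') / 3, (b - c') / 3, c, ?_, ?_⟩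
  · rw [divergence, h0, h1, pderiv_zero_quadForm, pderiv_one_quadForm]
    simp only [linForm, map_add]
    ring
  · rw [fixedPointPoly, h0, h1]
    refine MvPolynomial.funext fun x => ?_
    simp [quadForm, cubForm]
    ring

/-- Euler's relation expresses the two forms through the pair `(f, g)`. -/
theorem three_mul_F_zero (φ : QuadMap K) :
    C 3 * φ.F 0 = pderiv 1 φ.fixedPointPoly + X 0 * φ.divergence := by
  obtain ⟨a, b, c, h0⟩ := exists_eq_quadForm (φ.isHomogeneous 0)
  obtain ⟨a', b', c', h1⟩ := exists_eq_quadForm (φ.isHomogeneous 1)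
  rw [divergence, fixedPointPoly, h0, h1, map_sub, pderiv_mul, pderiv_mul]
  refine MvPolynomial.funext fun x => ?_
  simp
  simp [quadForm, linForm]
  ring

theorem three_mul_F_one (φ : QuadMap K) :
    C 3 * φ.F 1 = X 1 * φ.divergence - pderiv 0 φ.fixedPointPoly := by
  obtain ⟨a, b, c, h0⟩ := exists_eq_quadForm (φ.isHomogeneous 0)
  obtain ⟨a', b', c', h1⟩ := exists_eq_quadForm (φ.isHomogeneous 1)
  rw [divergence, fixedPointPoly, h0, h1, map_sub, pderiv_mul, pderiv_mul]
  refine MvPolynomial.funext fun x => ?_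
  simp
  simp [quadForm, linForm]
  ring

theorem F_eq_of_pair_eq {φ ψ : QuadMap K} (hf : φ.divergence = ψ.divergence)
    (hg : φ.fixedPointPoly = ψ.fixedPointPoly) : φ.F = ψ.F := by
  have h3 : (C 3 : MvPolynomial (Fin 2) K) ≠ 0 := by simp
  funext i
  refine mul_left_cancel₀ h3 ?_
  fin_cases i
  · exact (φ.three_mul_F_zero.trans (by rw [hf, hg])).trans ψ.three_mul_F_zero.symm
  · exact (φ.three_mul_F_one.trans (by rw [hf, hg])).trans ψ.three_mul_F_one.symm

/-- A quadratic map is defined over a subfield as soon as its pair `(f, g)` is. -/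
theorem definedOver_of_pair {k : Type*} [Field k] [Algebra k K] (φ : QuadMap K)
    {f g : MvPolynomial (Fin 2) k} (hf : φ.divergence = map (algebraMap k K) f)
    (hg : φ.fixedPointPoly = map (algebraMap k K) g) : φ.DefinedOver k := by
  have h3 : (C 3 : MvPolynomial (Fin 2) K) ≠ 0 := by simp
  have hC : ∀ p : MvPolynomial (Fin 2) K, C 3 * (map (algebraMap k K) (C (3⁻¹ : k)) * p) = p := by
    intro p
    rw [map_C, ← mul_assoc, ← map_mul, map_inv₀, map_ofNat, mul_inv_cancel₀ (by norm_num), map_one,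
      one_mul]
  intro i
  fin_cases i
  · refine ⟨C 3⁻¹ * (pderiv 1 g + X 0 * f), mul_left_cancel₀ h3 ?_⟩
    rw [map_mul, hC]
    refine Eq.trans ?_ φ.three_mul_F_zero.symm
    rw [hf, hg, map_add, map_mul, map_X, pderiv_map]
  · refine ⟨C 3⁻¹ * (X 1 * f - pderiv 0 g), mul_left_cancel₀ h3 ?_⟩
    rw [map_mul, hC]
    refine Eq.trans ?_ φ.three_mul_F_one.symm
    rw [hf, hg, map_sub, map_mul, map_X, pderiv_map]

end QuadMap

/-! ### Maps with vanishing `r` have an automorphism -/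

section CubicCovariant

variable {R : Type*} [CommRing R]

/-- Write `g(·, ·, ·)` for the symmetric trilinear form of the cubic `g = (a, b, c, d)`, and put
`q = (u, v)`, `L(x) = g(q, q, x)`. The value `t(q)` of the covariant `t = (g, (g, g)₂)₁` satisfies
`g(x) g(q)² - 3 L(x) g(q) g(x, x, q) + 2 L(x)³ = -[q, x]³ t(q)`, where `[q, x]` is the
determinant. -/
theorem cubic_syzygy (a b c d u v x y : R) :
    (a * x ^ 3 + 3 * b * x ^ 2 * y + 3 * c * x * y ^ 2 + d * y ^ 3) *
        (a * u ^ 3 + 3 * b * u ^ 2 * v + 3 * c * u * v ^ 2 + d * v ^ 3) ^ 2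
      - 3 * ((a * u ^ 2 + 2 * b * u * v + c * v ^ 2) * x
          + (b * u ^ 2 + 2 * c * u * v + d * v ^ 2) * y) *
        (a * u ^ 3 + 3 * b * u ^ 2 * v + 3 * c * u * v ^ 2 + d * v ^ 3) *
        ((a * u + b * v) * x ^ 2 + 2 * (b * u + c * v) * x * y + (c * u + d * v) * y ^ 2)
      + 2 * ((a * u ^ 2 + 2 * b * u * v + c * v ^ 2) * x
          + (b * u ^ 2 + 2 * c * u * v + d * v ^ 2) * y) ^ 3 =
    -(u * y - v * x) ^ 3 *
      ((3 * a * b * c - 2 * b ^ 3 - a ^ 2 * d) * u ^ 3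
        + 3 * (2 * a * c ^ 2 - b ^ 2 * c - a * b * d) * (u ^ 2 * v)
        + 3 * (a * c * d + b * c ^ 2 - 2 * b ^ 2 * d) * (u * v ^ 2)
        + (a * d ^ 2 - 3 * b * c * d + 2 * c ^ 3) * v ^ 3) := by
  ring

end CubicCovariant

/-- Over an algebraically closed field every binary cubic form has a zero on the projective
line, the zero form included. -/
theorem exists_zero_cubic {K : Type*} [Field K] [IsAlgClosed K] (a b c d : K) :
    ∃ u v : K, (u ≠ 0 ∨ v ≠ 0) ∧
      a * u ^ 3 + 3 * b * (u ^ 2 * v) + 3 * c * (u * v ^ 2) + d * v ^ 3 = 0 := by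
  by_cases ha : a = 0
  · exact ⟨1, 0, Or.inl one_ne_zero, by simp [ha]⟩
  · obtain ⟨x, hx⟩ := IsAlgClosed.exists_root (Cubic.toPoly ⟨a, 3 * b, 3 * c, d⟩)
      (by rw [Cubic.degree_of_a_ne_zero ha]; norm_num)
    refine ⟨x, 1, Or.inr one_ne_zero, ?_⟩
    simp only [Polynomial.IsRoot, Cubic.toPoly, Polynomial.eval_add, Polynomial.eval_mul,
      Polynomial.eval_C, Polynomial.eval_pow, Polynomial.eval_X] at hx
    linear_combination hx

namespace QuadMap

variable {K : Type*} [Field K] [CharZero K]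

/-- If the root of `f` is also a root `q` of the cubic covariant `t` of `g`, then the involution
`x ↦ -x + 2 g(q, q, x) / g(q) · q`, which fixes `q`, is an automorphism: it preserves `g` and
changes the sign of `f`. -/
theorem not_hasTrivialAut_of_common_zero (φ : QuadMap K) {p q a b c d u v : K}
    (hf : φ.divergence = linForm p q) (hg : φ.fixedPointPoly = cubForm a b c d)
    (huv : u ≠ 0 ∨ v ≠ 0) (hfq : p * u + q * v = 0)
    (ht : (3 * a * b * c - 2 * b ^ 3 - a ^ 2 * d) * u ^ 3
        + 3 * (2 * a * c ^ 2 - b ^ 2 * c - a * b * d) * (u ^ 2 * v)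
        + 3 * (a * c * d + b * c ^ 2 - 2 * b ^ 2 * d) * (u * v ^ 2)
        + (a * d ^ 2 - 3 * b * c * d + 2 * c ^ 3) * v ^ 3 = 0) :
    ¬ φ.HasTrivialAut := by
  have syz := fun x y => (cubic_syzygy a b c d u v x y).trans (by rw [ht, mul_zero])
  have hG : a * u ^ 3 + 3 * b * u ^ 2 * v + 3 * c * u * v ^ 2 + d * v ^ 3 =
      (a * u ^ 2 + 2 * b * u * v + c * v ^ 2) * u
        + (b * u ^ 2 + 2 * c * u * v + d * v ^ 2) * v := by ring
  have hl0 : (a * u ^ 2 + 2 * b * u * v + c * v ^ 2) * 3 =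
      eval ![u, v] (pderiv 0 φ.fixedPointPoly) := by
    rw [hg]
    simp [quadForm]
    ring
  have hl1 : (b * u ^ 2 + 2 * c * u * v + d * v ^ 2) * 3 =
      eval ![u, v] (pderiv 1 φ.fixedPointPoly) := by
    rw [hg]
    simp [quadForm]
    ring
  generalize hl : a * u ^ 2 + 2 * b * u * v + c * v ^ 2 = l at *
  generalize hm : b * u ^ 2 + 2 * c * u * v + d * v ^ 2 = m at *
  generalize hGe : a * u ^ 3 + 3 * b * u ^ 2 * v + 3 * c * u * v ^ 2 + d * v ^ 3 = G at *
  have hG0 : G ≠ 0 := by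
    -- If `g(q) = 0` as well, the syzygy makes `q` a multiple zero of `g`; since `f(q) = 0`, it is
    -- then a common zero of `F₀` and `F₁`.
    rintro rfl
    have h0 : l = 0 := by simpa using syz 1 0
    have h1 : m = 0 := by simpa using syz 0 1
    have hfe : eval ![u, v] φ.divergence = 0 := by
      rw [hf]
      simpa [linForm] using hfq
    refine φ.not_common_zero huv fun i => ?_
    have h3 : (3 : K) ≠ 0 := by norm_num
    refine mul_left_cancel₀ h3 ?_
    fin_cases i
    · have h := congrArg (eval ![u, v]) φ.three_mul_F_zero
      rw [map_mul, eval_C, map_add, map_mul, hfe, ← hl1, h1] at h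
      simpa using h
    · have h := congrArg (eval ![u, v]) φ.three_mul_F_one
      rw [map_mul, eval_C, map_sub, map_mul, hfe, ← hl0, h0] at h
      simpa using h
  -- The matrix of the involution `x ↦ -x + 2 g(q, q, x) / g(q) · q`.
  set A : Matrix (Fin 2) (Fin 2) K :=
    !![-1 + 2 * u * l / G, 2 * u * m / G; 2 * v * l / G, -1 + 2 * v * m / G] with hA
  have hdet : A.det = -1 := by
    rw [hA, Matrix.det_fin_two_of]
    field_simp
    linear_combination 2 * G * hG
  intro haut
  let γ : GL (Fin 2) K := Matrix.GeneralLinearGroup.mkOfDetNeZero A (by rw [hdet]; simp)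
  have hγA : γ.val = A := rfl
  have hconj : (φ.conj γ (-1) (by simp)).F = φ.F := by
    apply F_eq_of_pair_eq
    · rw [divergence_conj, hf, hγA, linSubst_linForm]
      refine MvPolynomial.funext fun x => ?_
      simp only [hA, linForm, map_add, map_mul, eval_C, eval_X, Matrix.of_apply, Matrix.cons_val',
        Matrix.cons_val_zero, Matrix.cons_val_one, Matrix.cons_val_fin_one]
      field_simp
      linear_combination -2 * (l * x 0 + m * x 1) * hfq
    · rw [fixedPointPoly_conj, hg, hγA, hdet]
      refine MvPolynomial.funext fun z => ?_
      have hs := syz (z 0) (z 1)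
      simp only [cubForm, map_add, map_mul, map_pow, map_ofNat, linSubst_X, linSubst_C, eval_C,
        eval_X]
      simp only [hA, Matrix.of_apply, Matrix.cons_val', Matrix.cons_val_zero, Matrix.cons_val_one,
        Matrix.cons_val_fin_one]
      generalize z 0 = x at *
      generalize z 1 = y at *
      -- With `n = L(x) / G` the involution is `x ↦ -x + 2nq`, and the syzygy says exactly that
      -- `g` takes the same value at `x` and at its image.
      obtain ⟨n, hn⟩ : ∃ n, n * G = l * x + m * y := ⟨(l * x + m * y) / G, by field_simp⟩
      have e0 : (-1 + 2 * u * l / G) * x + 2 * u * m / G * y = -x + 2 * n * u := by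
        field_simp
        linear_combination -2 * u * hn
      have e1 : 2 * v * l / G * x + (-1 + 2 * v * m / G) * y = -y + 2 * n * v := by
        field_simp
        linear_combination -2 * v * hn
      rw [e0, e1]
      rw [← hn] at hs
      have hG2 : G ^ 2 ≠ 0 := pow_ne_zero 2 hG0
      have hs' : a * x ^ 3 + 3 * b * x ^ 2 * y + 3 * c * x * y ^ 2 + d * y ^ 3
          - 3 * n * ((a * u + b * v) * x ^ 2 + 2 * (b * u + c * v) * x * y
            + (c * u + d * v) * y ^ 2) + 2 * n ^ 3 * G = 0 := by
        refine mul_left_cancel₀ hG2 ?_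
        linear_combination hs
      subst hl hm hGe
      linear_combination (-2) * hs' + 12 * n ^ 2 * hn
  have hcen := haut γ ⟨-1, by simp, hconj.symm⟩
  rw [Matrix.GeneralLinearGroup.mem_center_iff_val_mem_range_scalar] at hcen
  obtain ⟨s, hs⟩ := hcen
  rw [hγA] at hs
  -- A scalar matrix of trace `0` vanishes, whereas the involution has determinant `-1`.
  have htr : A.trace = 0 := by
    rw [hA, Matrix.trace_fin_two_of]
    field_simp
    linear_combination -2 * hG
  rw [← hs] at htr hdet
  simp at htr
  rw [htr] at hdet
  simp at hdet

/-- Up to sign, `r` is the value of `t` at the root of `f`. Where it vanishes, that root (any root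
of `t` if `f = 0`) gives an automorphism. -/
theorem invariants_three_ne_zero [IsAlgClosed K] (φ : QuadMap K) (h : φ.HasTrivialAut) :
    φ.invariants 3 ≠ 0 := by
  obtain ⟨p, q, a, b, c, d, hf, hg⟩ := φ.exists_coordinates
  intro hr
  rw [invariants, hf, hg, basicInvariants_forms] at hr
  simp only [Matrix.cons_val] at hr
  by_cases hpq : p = 0 ∧ q = 0
  · obtain ⟨u, v, huv, ht⟩ := exists_zero_cubic (3 * a * b * c - 2 * b ^ 3 - a ^ 2 * d)
      (2 * a * c ^ 2 - b ^ 2 * c - a * b * d) (a * c * d + b * c ^ 2 - 2 * b ^ 2 * d)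
      (a * d ^ 2 - 3 * b * c * d + 2 * c ^ 3)
    exact φ.not_hasTrivialAut_of_common_zero hf hg huv (by simp [hpq]) ht h
  · -- The root of `f = p X₀ + q X₁` is `(q : -p)`.
    refine φ.not_hasTrivialAut_of_common_zero hf hg (u := q) (v := -p) ?_ (by ring) ?_ h
    · rw [neg_ne_zero]
      tauto
    · linear_combination -hr

end QuadMap

/-! ### The model over the field of the invariants -/

section Models

theorem map_modelLinear {k K : Type*} [Field k] [Field K] (i : k →+* K) (s₁ s₂ : k)
    (W : Fin 2 → MvPolynomial (Fin 2) k) :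
    map i (modelLinear s₁ s₂ W) = modelLinear (i s₁) (i s₂) fun j => map i (W j) := by
  simp [modelLinear, bVal]

theorem map_aVal {k K : Type*} [Field k] [Field K] (e : k →+* K) (s₁ s₂ s₃ r : k)
    (i j l : Fin 2) :
    e (aVal s₁ s₂ s₃ r i j l) = aVal (e s₁) (e s₂) (e s₃) (e r) i j l := by
  fin_cases i <;> fin_cases j <;> fin_cases l <;> simp [aVal, map_ofNat e]

theorem map_modelCubic {k K : Type*} [Field k] [Field K] (e : k →+* K) (s₁ s₂ s₃ r : k)
    (W : Fin 2 → MvPolynomial (Fin 2) k) :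
    map e (modelCubic s₁ s₂ s₃ r W) =
      modelCubic (e s₁) (e s₂) (e s₃) (e r) fun j => map e (W j) := by
  simp [modelCubic, map_aVal, map_ofNat e]

variable {K : Type*} [Field K] (A : Matrix (Fin 2) (Fin 2) K)

theorem linSubst_modelLinear (s₁ s₂ : K) (W : Fin 2 → MvPolynomial (Fin 2) K) :
    linSubst A (modelLinear s₁ s₂ W) = modelLinear s₁ s₂ fun j => linSubst A (W j) := by
  simp only [modelLinear, map_sub, map_mul, linSubst_C]

theorem linSubst_modelCubic (s₁ s₂ s₃ r : K) (W : Fin 2 → MvPolynomial (Fin 2) K) :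
    linSubst A (modelCubic s₁ s₂ s₃ r W) = modelCubic s₁ s₂ s₃ r fun j => linSubst A (W j) := by
  simp only [modelCubic, map_sum, map_mul (linSubst A), linSubst_C]

end Models

namespace QuadMap

variable {K : Type*} [Field K] [CharZero K]

/-- Rescaling a representative rescales its invariants in the weighted sense. -/
theorem invariants_conj_one (φ : QuadMap K) (α : K) (hα : α ≠ 0) (i : Fin 4) :
    (φ.conj 1 α hα).invariants i = α ^ (![4, 4, 4, 6] i : ℕ) * φ.invariants i := by
  obtain ⟨p, q, a, b, c, d, hf, hg⟩ := φ.exists_coordinates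
  rw [invariants, invariants, divergence_conj, fixedPointPoly_conj, hf, hg, Units.val_one,
    linSubst_one, linSubst_one, Matrix.det_one, inv_one, mul_one, basicInvariants_C_mul]

/-- A map with `r ≠ 0` is conjugate to the model
built from any two linear forms `W₀, W₁` of determinant one: the conjugation takes the linear
covariants `V₀, V₁`, whose determinant is `r`, to `W₀, W₁`. -/
theorem exists_conj_eq_model (φ : QuadMap K) {s₁ s₂ s₃ r : K}
    (h : φ.invariants = ![s₁, s₂, s₃, r]) (hr : r ≠ 0) (N : Matrix (Fin 2) (Fin 2) K)
    (hN : N.det = 1) :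
    ∃ ψ : QuadMap K, ψ.toPoint = φ.toPoint ∧
      ψ.divergence = modelLinear s₁ s₂ (fun i => linForm (N i 0) (N i 1)) ∧
      ψ.fixedPointPoly = modelCubic s₁ s₂ s₃ r (fun i => linForm (N i 0) (N i 1)) := by
  obtain ⟨p, q, a, b, c, d, hf, hg⟩ := φ.exists_coordinates
  rw [invariants, hf, hg] at h
  have h₁ := congrFun h 0
  have h₂ := congrFun h 1
  have h₃ := congrFun h 2
  have hr' := congrFun h 3
  simp only [Matrix.cons_val] at h₁ h₂ h₃ hr'
  set M := covVMatrix p q a b c d with hM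
  have hdetM : M.det = r := by rw [hM, det_covVMatrix, hr']
  have hMu : IsUnit M.det := by rw [hdetM]; exact isUnit_iff_ne_zero.2 hr
  have hdet : (M⁻¹ * N).det = r⁻¹ := by
    rw [Matrix.det_mul, hN, mul_one, Matrix.det_nonsing_inv, hdetM, Ring.inverse_eq_inv']
  let γ : GL (Fin 2) K := Matrix.GeneralLinearGroup.mkOfDetNeZero (M⁻¹ * N)
    (by rw [hdet]; exact inv_ne_zero hr)
  have hγv : γ.val = M⁻¹ * N := rfl
  have hW : (fun i => linSubst γ.val (covV (linForm p q) (cubForm a b c d) i)) =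
      fun i => linForm (N i 0) (N i 1) := by
    funext i
    have hV : covV (linForm p q) (cubForm a b c d) i = linForm (M i 0) (M i 1) := by
      rw [covV_forms, hM, covVMatrix]
      fin_cases i <;> rfl
    have hMN : M * γ.val = N := by rw [hγv, Matrix.mul_nonsing_inv_cancel_left _ _ hMu]
    rw [hV, linSubst_linForm]
    conv_rhs => rw [← hMN]
    simp only [Matrix.mul_apply, Fin.sum_univ_two]
  refine ⟨φ.conj γ r hr, toPoint_conj _ _ _ _, ?_, ?_⟩
  · rw [divergence_conj, hf, ← hW, ← linSubst_modelLinear, modelLinear_covV p q a b c d s₁ s₂ r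
      h₁ h₂ hr', map_mul, linSubst_C]
  · rw [fixedPointPoly_conj, hg, ← hW, ← linSubst_modelCubic,
      modelCubic_covV p q a b c d s₁ s₂ s₃ r h₁ h₂ h₃ hr' hr, map_mul (linSubst _),
      linSubst_C, hγv, hdet, inv_inv, pow_two]

end QuadMap

theorem mainTheorem5 {k K : Type*} [Field k] [CharZero k] [Field K] [Algebra k K]
    [IsAlgClosure k K] (P : M2 K) (hP : P.IsRationalOver k) (hAut : P.HasTrivialAut)
    (s₁ s₂ s₃ r : k)
    (hcoord : P.IsWeightedCoords (fun i => algebraMap k K (![s₁, s₂, s₃, r] i))) :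
    r ≠ 0 ∧
    (∃ φ : QuadMap K, φ.toPoint = P ∧
      φ.invariants = fun i => algebraMap k K (![s₁, s₂, s₃, r] i)) ∧
    (∀ φ : QuadMap K, φ.toPoint = P →
      (φ.invariants = fun i => algebraMap k K (![s₁, s₂, s₃, r] i)) →
      (∀ i, covB φ.divergence φ.fixedPointPoly i = algebraMap k K (bVal s₁ s₂ i)) ∧
      ∀ i j l, covA φ.divergence φ.fixedPointPoly i j l =
        algebraMap k K (aVal s₁ s₂ s₃ r i j l)) ∧
    ∀ N : Matrix.SpecialLinearGroup (Fin 2) k,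
      ∃ φ : QuadMap K, φ.DefinedOver k ∧
        φ.divergence = MvPolynomial.map (algebraMap k K) (modelLinear s₁ s₂ (linearForms N)) ∧
        φ.fixedPointPoly =
          MvPolynomial.map (algebraMap k K) (modelCubic s₁ s₂ s₃ r (linearForms N)) ∧
        φ.toPoint = P := by
  have : IsAlgClosed K := IsAlgClosure.isAlgClosed k
  have : CharZero K := charZero_of_injective_algebraMap (algebraMap k K).injective
  have hvec : (fun i => algebraMap k K (![s₁, s₂, s₃, r] i)) =
      ![algebraMap k K s₁, algebraMap k K s₂, algebraMap k K s₃, algebraMap k K r] := by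
    funext i
    fin_cases i <;> rfl
  obtain ⟨φ₀, hφ₀, α, hα, hx⟩ := hcoord
  -- A representative whose invariants are the given coordinates on the nose.
  obtain ⟨φ, hφ, hinv⟩ : ∃ φ : QuadMap K, φ.toPoint = P ∧
      φ.invariants = fun i => algebraMap k K (![s₁, s₂, s₃, r] i) :=
    ⟨φ₀.conj 1 α hα, (φ₀.toPoint_conj 1 α hα).trans hφ₀,
      funext fun i => (φ₀.invariants_conj_one α hα i).trans (hx i).symm⟩
  have hr : algebraMap k K r ≠ 0 := by
    have h := φ.invariants_three_ne_zero (hAut φ hφ)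
    rw [hinv] at h
    exact h
  refine ⟨fun h => hr (by rw [h, map_zero]), ⟨φ, hφ, hinv⟩, ?_, ?_⟩
  · intro ψ _ hψ
    obtain ⟨p, q, a, b, c, d, hf, hg⟩ := ψ.exists_coordinates
    rw [QuadMap.invariants, hf, hg, hvec] at hψ
    rw [hf, hg]
    refine ⟨fun i => ?_, fun i j l => ?_⟩
    · rw [covB_forms, hψ]
      fin_cases i <;> rfl
    · rw [covA_forms, hψ, map_aVal]
      rfl
  · intro N
    have hN : (N.val.map (algebraMap k K)).det = 1 := by
      have h := (algebraMap k K).map_det N.val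
      rw [N.det_coe, map_one] at h
      exact h.symm
    have hW : (fun i => map (algebraMap k K) (linearForms N i)) = fun i =>
        linForm (N.val.map (algebraMap k K) i 0) (N.val.map (algebraMap k K) i 1) := by
      funext i
      simp [linearForms, linForm, Fin.sum_univ_two]
    obtain ⟨ψ, hψ, hf, hg⟩ :=
      φ.exists_conj_eq_model (hinv.trans hvec) hr (N.val.map (algebraMap k K)) hN
    rw [← hW, ← map_modelLinear] at hf
    rw [← hW, ← map_modelCubic] at hg
    exact ⟨ψ, ψ.definedOver_of_pair hf hg, hf, hg, hψ.trans hφ⟩
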